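/- Let $H$ be a unimodular amenable locally compact (Hausdorff) group with Haar measure $dh$, where amenable means that there is a left-invariant mean on the bounded continuous functions on $H$. Let $\pi$ be a strongly continuous unitary representation of $H$ on a complex Hilbert space $\mathcal H$ with inner product $(\cdot,\cdot)$ linear in the first entry, and let $L\subseteq\mathcal H$ be a linear subspace such that for all $\psi,\varphi\in L$ the function $$\langle\psi,\varphi\rangle_{C_c(H)}:\ h\mapsto(\pi(h)\varphi,\psi)$$ has compact support, i.e. lies in $C_c(H)$ (for $H$ compact one may take $L=\mathcal H$). Let $C^*(H)$ be the group $C^*$-algebra, the completion of the convolution $*$-algebra $C_c(H)$ in the norm $\|f\|=\sup_{\pi_1}\|\pi_1(f)\|$, where $\pi_1$ runs over the unitary representations of $H$ and $\pi_1(f)=\int_H f(h)\,\pi_1(h)\,dh$. Let $A\in\pi(H)'$ be a bounded operator on $\mathcal H$ commuting with all $\pi(h)$, $h\in H$. Then for every $\psi\in L$ with $A\psi\in L$ (hence for every $\psi\in L$ if $A$ maps $L$ into itself), $$\langle A\psi,A\psi\rangle_{C_c(H)}\ \le\ \|A\|^2\,\langle\psi,\psi\rangle_{C_c(H)}$$ in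 $C^*(H)$, i.e. the difference of the right- and the left-hand side is a positive element of the $C^*$-algebra $C^*(H)$. -/

import Mathlib

open MeasureTheory
open scoped CompactlySupported BoundedContinuousFunction ENNReal

universe u v

noncomputable section

namespace RieffelInduction

/-- A strongly continuous unitary representation of the topological group `H` on the Hilbert
space `E`. -/
structure UnitaryRep (H : Type u) [Group H] [TopologicalSpace H] (E : Type v)
    [NormedAddCommGroup E] [InnerProductSpace ℂ E] [CompleteSpace E] where
  /-- the underlying homomorphism into the unitary group -/
  hom : H →* unitary (E →L[ℂ] E)
  /-- strong continuity -/
  continuous_hom : ∀ v : E, Continuous fun h : H => (hom h : E →L[ℂ] E) v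

namespace UnitaryRep

variable {H : Type u} [Group H] [TopologicalSpace H] {E : Type v}
  [NormedAddCommGroup E] [InnerProductSpace ℂ E] [CompleteSpace E]

/-- The operator `π(h)`. -/
def op (π : UnitaryRep H E) (h : H) : E →L[ℂ] E := (π.hom h : E →L[ℂ] E)

theorem continuous_op (π : UnitaryRep H E) (v : E) : Continuous fun h : H => π.op h v :=
  π.continuous_hom v

theorem norm_op_apply (π : UnitaryRep H E) (h : H) (v : E) : ‖π.op h v‖ = ‖v‖ :=
  ContinuousLinearMap.norm_map_of_mem_unitary (π.hom h).2 v

section Integrated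

variable [MeasurableSpace H] [BorelSpace H] (μ : Measure H) [IsFiniteMeasureOnCompacts μ]

theorem integrable_smul_op (π : UnitaryRep H E) (f : C_c(H, ℂ)) (v : E) :
    Integrable (fun h => f h • π.op h v) μ :=
  (f.continuous.smul (π.continuous_op v)).integrable_of_hasCompactSupport
    f.hasCompactSupport.smul_right

theorem norm_integral_smul_op_le (π : UnitaryRep H E) (f : C_c(H, ℂ)) (v : E) :
    ‖∫ h, f h • π.op h v ∂μ‖ ≤ (∫ h, ‖f h‖ ∂μ) * ‖v‖ := by
  refine (norm_integral_le_integral_norm _).trans (le_of_eq ?_)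
  simp only [norm_smul, norm_op_apply]
  exact integral_mul_const _ _

/-- The integrated form `π(f) = ∫ f(h) π(h) dh` for `f ∈ C_c(H)`, as a bounded operator. -/
def integrated (π : UnitaryRep H E) (f : C_c(H, ℂ)) : E →L[ℂ] E :=
  LinearMap.mkContinuous
    { toFun := fun v => ∫ h, f h • π.op h v ∂μ
      map_add' := fun v w => by
        simp only [map_add, smul_add]
        exact integral_add (π.integrable_smul_op μ f v) (π.integrable_smul_op μ f w)
      map_smul' := fun c v => by
        simp only [map_smul, RingHom.id_apply, smul_comm _ c]
        exact integral_smul c _ }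
    (∫ h, ‖f h‖ ∂μ) (π.norm_integral_smul_op_le μ f)

theorem norm_integrated_le (π : UnitaryRep H E) (f : C_c(H, ℂ)) :
    ‖π.integrated μ f‖ ≤ ∫ h, ‖f h‖ ∂μ :=
  LinearMap.mkContinuous_norm_le _ (integral_nonneg fun _ => norm_nonneg _) _

end Integrated

/-- The matrix coefficient `h ↦ (π(h) φ, ψ)`. The inner product of the Hilbert space, written
`(·,·)`, is linear in its first entry; `inner ℂ ψ w` is `(w, ψ)`. -/
def coeff (π : UnitaryRep H E) (ψ φ : E) (h : H) : ℂ := inner ℂ ψ (π.op h φ)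

theorem continuous_coeff (π : UnitaryRep H E) (ψ φ : E) : Continuous (π.coeff ψ φ) :=
  continuous_const.inner (π.continuous_op φ)

/-- The condition on a linear subspace `L` that `h ↦ (π(h) φ, ψ)` be an element of `C_c(H)` for
all `ψ, φ ∈ L` (continuity is automatic). -/
def HasCompactCoeffs (π : UnitaryRep H E) (L : Submodule ℂ E) : Prop :=
  ∀ ψ ∈ L, ∀ φ ∈ L, HasCompactSupport (π.coeff ψ φ)

/-- The rigging map `⟨ψ, φ⟩ : h ↦ (π(h) φ, ψ)` on `L`, with values in `C_c(H)`. -/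
def rigging (π : UnitaryRep H E) {L : Submodule ℂ E} (hL : π.HasCompactCoeffs L) (ψ φ : L) :
    C_c(H, ℂ) where
  toFun := π.coeff ψ φ
  continuous_toFun := π.continuous_coeff ψ φ
  hasCompactSupport' := hL ψ ψ.2 φ φ.2

end UnitaryRep

section GroupCStarAlgebra

/-- All unitary representations of `H` on Hilbert spaces in the universe of `H`. Every cyclic
representation of `H` is equivalent to one of these, because it has a dense subset of cardinality
at most `max (#H) ℵ₀`. -/
structure BundledRep (H : Type u) [Group H] [TopologicalSpace H] : Type (u + 1) where
  /-- the Hilbert space -/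
  space : Type u
  [normed : NormedAddCommGroup space]
  [inner : InnerProductSpace ℂ space]
  [complete : CompleteSpace space]
  /-- the representation on it -/
  rep : UnitaryRep H space

attribute [instance] BundledRep.normed BundledRep.inner BundledRep.complete

/-- The `C*`-algebra `∏_π B(E_π)` of bounded families of operators, with norm `sup_π ‖x_π‖`,
where `π` runs over the unitary representations of `H`. -/
abbrev OpFamilies (H : Type u) [Group H] [TopologicalSpace H] : Type (u + 1) :=
  lp (fun π : BundledRep H => π.space →L[ℂ] π.space) ∞

variable {H : Type u} [Group H] [TopologicalSpace H] [MeasurableSpace H] [BorelSpace H]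
  (μ : Measure H) [IsFiniteMeasureOnCompacts μ]

/-- The family `(π(f))_π`. Its norm is the universal `C*`-norm `sup_π ‖π(f)‖` of `f`. -/
def universalRep (f : C_c(H, ℂ)) : OpFamilies H :=
  ⟨fun π => π.rep.integrated μ f, memℓp_infty ⟨∫ h, ‖f h‖ ∂μ, by
    rintro _ ⟨π, rfl⟩
    exact π.rep.norm_integrated_le μ f⟩⟩

/-- The closed `*`-subalgebra generated by the families `(π(f))_π`, `f ∈ C_c(H)`. For a Haar
measure `μ` these families already form a `*`-algebra, with convolution as product, so that this
is the completion of the convolution algebra `C_c(H)` in its universal `C*`-norm. -/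
def groupCStarSubalgebra : NonUnitalStarSubalgebra ℂ (OpFamilies H) :=
  (NonUnitalStarAlgebra.adjoin ℂ (Set.range (universalRep μ))).topologicalClosure

/-- The group `C*`-algebra `C*(H)`. -/
def GroupCStar : Type (u + 1) := groupCStarSubalgebra μ

instance : NonUnitalCStarAlgebra (GroupCStar μ) :=
  NonUnitalStarSubalgebra.nonUnitalCStarAlgebra (groupCStarSubalgebra μ)
    (h_closed := NonUnitalStarSubalgebra.isClosed_topologicalClosure _)

/-- The usual order of the `C*`-algebra `C*(H)`: `a ≤ b` if and only if `b - a` is positive, that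
is, self-adjoint with spectrum in `[0, ∞)`; equivalently, `b - a = c* c` for some `c ∈ C*(H)`. -/
instance : PartialOrder (GroupCStar μ) := CStarAlgebra.spectralOrder _

instance : StarOrderedRing (GroupCStar μ) := CStarAlgebra.spectralOrderedRing _

/-- The canonical map `C_c(H) → C*(H)`. -/
def toGroupCStar (f : C_c(H, ℂ)) : GroupCStar μ :=
  ⟨universalRep μ f, NonUnitalStarSubalgebra.le_topologicalClosure _
    (NonUnitalStarAlgebra.subset_adjoin ℂ _ ⟨f, rfl⟩)⟩

end GroupCStarAlgebra

/-- Amenability of a locally compact group: there is a left-invariant mean (a positive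
normalized left-invariant linear functional) on the bounded continuous real functions. -/
def IsAmenable (H : Type u) [Group H] [TopologicalSpace H] [IsTopologicalGroup H] : Prop :=
  ∃ m : (H →ᵇ ℝ) →ₗ[ℝ] ℝ,
    (∀ f : H →ᵇ ℝ, (∀ x, 0 ≤ f x) → 0 ≤ m f) ∧
    m (BoundedContinuousFunction.const H 1) = 1 ∧
    ∀ (h : H) (f : H →ᵇ ℝ), m (f.compContinuous ⟨fun x => h * x, continuous_const_mul h⟩) = m f

end RieffelInduction

end

open RieffelInduction

noncomputable section

namespace RieffelInduction

open Filter Topology Set Function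

set_option linter.unusedSectionVars false

/-! Put `D = ‖A‖² - A*A ≥ 0` and `η = √D ψ`. Since `√D` commutes with `π(H)`, the difference of the
two sides is the diagonal coefficient of `η` (`UnitaryRep.exists_coeff_eq_sub`). Positivity in
`C*(H)` can be tested in each representation `ρ` (`GroupCStar.nonneg_of_evalRep_nonneg`), where it
says that `∫ (π(h)η, η)(ρ(h)v, v) dh ≥ 0` for every `v`.

The integrand `G` is the diagonal coefficient of `η ⊗ v` in `π ⊗ ρ`, continuous with compact
support. Against a coefficient `(λ(h)ξ, ξ)` of the regular representation its integral is a squared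
norm (`integral_mul_autocorrelation_nonneg`). Amenability makes such coefficients approximate `1`
uniformly on the support of `G`, so `∫ G ≥ 0` (`IsAmenable.integral_nonneg`).

The approximation is Reiter's property, applied with `ξ` the square root of an almost invariant
density. It is derived from the invariant mean by contradiction: if no density worked, Mazur–Orlicz
would give positive functionals on `C_c(H)` whose averages under the mean are multiples of the Haar
integral, hence vanish where they would have to be bounded below. -/

/-- A form of the Mazur–Orlicz theorem: a linear functional `l` dominated by a sublinear
functional along a linear map, on a cone, extends to a functional dominated by it everywhere. -/
theorem exists_linearMap_le_sublinear {X Y : Type*} [AddCommGroup X] [Module ℝ X]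
    [AddCommGroup Y] [Module ℝ Y] (p : X → ℝ)
    (p_hom : ∀ c : ℝ, 0 < c → ∀ x, p (c • x) = c * p x) (p_add : ∀ x y, p (x + y) ≤ p x + p y)
    (C : ConvexCone ℝ Y) (hC : (0 : Y) ∈ C) (T : Y →ₗ[ℝ] X) (l : Y →ₗ[ℝ] ℝ)
    (h : ∀ y ∈ C, l y ≤ p (T y)) :
    ∃ Θ : X →ₗ[ℝ] ℝ, (∀ x, Θ x ≤ p x) ∧ ∀ y ∈ C, l y ≤ Θ (T y) := by
  have p_zero : p 0 = 0 := by
    have := p_hom 2 two_pos 0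
    rw [smul_zero] at this
    linarith
  -- Domination by `N` encodes both conclusions at once: the term `y = 0` bounds `Θ` by `p`, and a
  -- general `y` bounds `l y` by `Θ (T y)`. Hahn–Banach then only has to extend the zero functional
  -- on `⊥`.
  let N : X → ℝ := fun x => ⨅ y : C, (p (x + T y) - l y)
  have bdd : ∀ x, BddBelow (range fun y : C => p (x + T y) - l y) := by
    intro x
    refine ⟨-p (-x), ?_⟩
    rintro _ ⟨y, rfl⟩
    have h1 := p_add (x + T y) (-x)
    have h2 := h y y.2
    rw [show x + T (y : Y) + -x = T y by abel] at h1
    simp only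
    linarith
  have : Nonempty C := ⟨⟨0, hC⟩⟩
  have N_le : ∀ x, ∀ y ∈ C, N x ≤ p (x + T y) - l y := fun x y hy => ciInf_le (bdd x) ⟨y, hy⟩
  have hN_hom_le : ∀ c : ℝ, 0 < c → ∀ x, N (c • x) ≤ c * N x := by
    intro c hc x
    rw [← div_le_iff₀' hc]
    refine le_ciInf fun y => ?_
    rw [div_le_iff₀' hc]
    refine (N_le _ _ (C.smul_mem hc y.2)).trans (le_of_eq ?_)
    rw [map_smul, map_smul, ← smul_add, p_hom c hc, smul_eq_mul]
    ring
  obtain ⟨Θ, -, hΘ⟩ := exists_extension_of_le_sublinear (E := X) ⟨⊥, 0⟩ N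
    (by
      intro c hc x
      refine le_antisymm (hN_hom_le c hc x) ?_
      have := hN_hom_le c⁻¹ (inv_pos.2 hc) (c • x)
      rw [smul_smul, inv_mul_cancel₀ hc.ne', one_smul] at this
      rwa [inv_mul_eq_div, le_div_iff₀' hc] at this)
    (by
      intro x y
      refine le_ciInf_add_ciInf fun a b => ?_
      refine (N_le _ _ (C.add_mem a.2 b.2)).trans ?_
      have := p_add (x + T a) (y + T b)
      rw [map_add, map_add, show x + y + (T (a : Y) + T b) = x + T a + (y + T b) by abel]
      linarith)
    (by
      rintro ⟨x, hx⟩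
      obtain rfl : x = 0 := by simpa using hx
      simp only [LinearPMap.mk_apply, LinearMap.zero_apply]
      refine le_ciInf fun y => ?_
      have := h y y.2
      rw [zero_add]
      linarith)
  refine ⟨Θ, fun x => (hΘ x).trans ?_, fun y hy => ?_⟩
  · simpa using N_le x 0 hC
  · have h1 := (hΘ (-T y)).trans (N_le _ y hy)
    rw [neg_add_cancel, p_zero, map_neg] at h1
    linarith

/-! ### Translations and correlations in `C_c(H)`; invariant functionals -/

section CompactlySupported

variable {H : Type u} [Group H] [TopologicalSpace H] [IsTopologicalGroup H]

/-- The translate `z ↦ f (a * z)`. -/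
def leftTranslate (a : H) (f : C_c(H, ℝ)) : C_c(H, ℝ) where
  toFun z := f (a * z)
  continuous_toFun := f.continuous.comp (continuous_const_mul a)
  hasCompactSupport' := f.hasCompactSupport.comp_homeomorph (Homeomorph.mulLeft a)

/-- The translate `z ↦ f (z * a)`. -/
def rightTranslate (a : H) (f : C_c(H, ℝ)) : C_c(H, ℝ) where
  toFun z := f (z * a)
  continuous_toFun := f.continuous.comp (continuous_mul_const a)
  hasCompactSupport' := f.hasCompactSupport.comp_homeomorph (Homeomorph.mulRight a)

@[simp] theorem leftTranslate_apply (a : H) (f : C_c(H, ℝ)) (z : H) :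
    leftTranslate a f z = f (a * z) := rfl

@[simp] theorem rightTranslate_apply (a : H) (f : C_c(H, ℝ)) (z : H) :
    rightTranslate a f z = f (z * a) := rfl

@[simp] theorem abs_compactlySupported_apply (f : C_c(H, ℝ)) (z : H) : |f| z = |f z| := rfl

variable [MeasurableSpace H] [BorelSpace H] (μ : Measure H) [IsFiniteMeasureOnCompacts μ]

theorem integrable_compactlySupported (f : C_c(H, ℝ)) : Integrable f μ :=
  f.continuous.integrable_of_hasCompactSupport f.hasCompactSupport

/-- The support in `z` may move with `a`; continuity is local, so one compact set over each compact
neighbourhood of `a` suffices. -/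
theorem continuous_integral_of_locally_compact_support [LocallyCompactSpace H]
    {V : Type*} [NormedAddCommGroup V] [NormedSpace ℝ V] {g : H → H → V}
    (hg : Continuous g.uncurry)
    (hs : ∀ N : Set H, IsCompact N → ∃ K : Set H, IsCompact K ∧ ∀ a ∈ N, ∀ z ∉ K, g a z = 0) :
    Continuous fun a => ∫ z, g a z ∂μ := by
  refine continuous_iff_continuousAt.2 fun a => ?_
  obtain ⟨N, hN, haN⟩ := exists_compact_mem_nhds a
  obtain ⟨K, hK, hz⟩ := hs N hN
  exact (continuousOn_integral_of_compact_support hK hg.continuousOn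
    fun a z ha => hz a ha z).continuousAt haN

/-- The correlation `z ↦ ∫ k(y) f(y z) dy` of two compactly supported functions. -/
def correlation [LocallyCompactSpace H] (k f : C_c(H, ℝ)) : C_c(H, ℝ) where
  toFun z := ∫ y, k y * f (y * z) ∂μ
  continuous_toFun := by
    refine continuous_integral_of_locally_compact_support μ (g := fun z y => k y * f (y * z))
      ?_ fun N _ => ⟨tsupport k, k.hasCompactSupport, fun z _ y hy => ?_⟩
    · exact (k.continuous.comp continuous_snd).mul
        (f.continuous.comp (continuous_snd.mul continuous_fst))
    · simp only [image_eq_zero_of_notMem_tsupport hy, zero_mul]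
  hasCompactSupport' := by
    refine HasCompactSupport.intro
      (K := (fun p : H × H => p.1⁻¹ * p.2) '' (tsupport k ×ˢ tsupport f))
      ((k.hasCompactSupport.isCompact.prod f.hasCompactSupport).image (by fun_prop)) fun z hz => ?_
    refine integral_eq_zero_of_ae (Eventually.of_forall fun y => ?_)
    by_cases hy : y ∈ tsupport k
    · have : y * z ∉ tsupport f := fun hf => hz ⟨(y, y * z), ⟨hy, hf⟩, by simp⟩
      simp [image_eq_zero_of_notMem_tsupport this]
    · simp [image_eq_zero_of_notMem_tsupport hy]

section Correlation

variable [LocallyCompactSpace H]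

theorem correlation_apply (k f : C_c(H, ℝ)) (z : H) :
    correlation μ k f z = ∫ y, k y * f (y * z) ∂μ := rfl

theorem integrable_correlation_integrand (k f : C_c(H, ℝ)) (z : H) :
    Integrable (fun y => k y * f (y * z)) μ :=
  integrable_compactlySupported μ (k * rightTranslate z f)

theorem correlation_add_left (k k' f : C_c(H, ℝ)) :
    correlation μ (k + k') f = correlation μ k f + correlation μ k' f := by
  ext z
  simp only [correlation_apply, CompactlySupportedContinuousMap.add_apply, add_mul]
  exact integral_add (integrable_correlation_integrand μ k f z)
    (integrable_correlation_integrand μ k' f z)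

theorem correlation_smul_left (c : ℝ) (k f : C_c(H, ℝ)) :
    correlation μ (c • k) f = c • correlation μ k f := by
  ext z
  simp only [correlation_apply, CompactlySupportedContinuousMap.smul_apply, smul_eq_mul, mul_assoc]
  exact integral_const_mul c _

theorem correlation_add_right (k f f' : C_c(H, ℝ)) :
    correlation μ k (f + f') = correlation μ k f + correlation μ k f' := by
  ext z
  simp only [correlation_apply, CompactlySupportedContinuousMap.add_apply, mul_add]
  exact integral_add (integrable_correlation_integrand μ k f z)
    (integrable_correlation_integrand μ k f' z)

theorem correlation_smul_right (c : ℝ) (k f : C_c(H, ℝ)) :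
    correlation μ k (c • f) = c • correlation μ k f := by
  ext z
  simp only [correlation_apply, CompactlySupportedContinuousMap.smul_apply, smul_eq_mul,
    mul_left_comm _ c]
  exact integral_const_mul c _

/-- The correlation as a bilinear map. -/
def correlationLinear : C_c(H, ℝ) →ₗ[ℝ] C_c(H, ℝ) →ₗ[ℝ] C_c(H, ℝ) :=
  LinearMap.mk₂ ℝ (correlation μ) (correlation_add_left μ) (correlation_smul_left μ)
    (correlation_add_right μ) (correlation_smul_right μ)

@[simp] theorem correlationLinear_apply (k f : C_c(H, ℝ)) :
    correlationLinear μ k f = correlation μ k f := rfl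

theorem correlation_nonneg {k f : C_c(H, ℝ)} (hk : 0 ≤ k) (hf : 0 ≤ f) :
    0 ≤ correlation μ k f := fun z =>
  integral_nonneg fun y => mul_nonneg (hk y) (hf (y * z))

theorem abs_correlation_le (k f : C_c(H, ℝ)) (z : H) :
    |correlation μ k f z| ≤ correlation μ |k| |f| z := by
  rw [correlation_apply, correlation_apply]
  refine abs_integral_le_integral_abs.trans (le_of_eq ?_)
  simp only [abs_mul, abs_compactlySupported_apply]

/-- Moves a translation of the kernel onto the second factor, where an invariant mean over
translates can absorb it. -/
theorem correlation_leftTranslate [μ.IsMulLeftInvariant] (a : H) (k f : C_c(H, ℝ)) :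
    correlation μ (leftTranslate a k) f = correlation μ k (leftTranslate a⁻¹ f) := by
  ext z
  simp only [correlation_apply, leftTranslate_apply]
  rw [← integral_mul_left_eq_self _ a⁻¹]
  simp [mul_assoc]

/-- Unimodularity enters through the substitution `y ↦ y a⁻¹`. The displacement of a correlation is
thereby governed by that of its kernel, uniformly in a normalized second factor. -/
theorem leftTranslate_correlation [μ.IsMulRightInvariant] (a : H) (k f : C_c(H, ℝ)) :
    leftTranslate a (correlation μ k f) = correlation μ (rightTranslate a⁻¹ k) f := by
  ext z
  simp only [correlation_apply, leftTranslate_apply, rightTranslate_apply]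
  rw [← integral_mul_right_eq_self _ a⁻¹]
  simp [mul_assoc]

theorem integral_correlation [μ.IsMulLeftInvariant] (k f : C_c(H, ℝ)) :
    ∫ z, correlation μ k f z ∂μ = (∫ y, k y ∂μ) * ∫ z, f z ∂μ := by
  simp only [correlation_apply]
  rw [integral_integral_swap_of_hasCompactSupport]
  · simp only [integral_const_mul, integral_mul_left_eq_self (fun z => f z), integral_mul_const]
  · exact (k.continuous.comp continuous_snd).mul
        (f.continuous.comp (continuous_snd.mul continuous_fst))
  · refine HasCompactSupport.intro
      (K := (fun p : H × H => (p.1⁻¹ * p.2, p.1)) '' (tsupport k ×ˢ tsupport f))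
      ((k.hasCompactSupport.isCompact.prod f.hasCompactSupport).image (by fun_prop)) ?_
    rintro ⟨z, y⟩ hz
    simp only [uncurry_apply_pair]
    by_cases hy : y ∈ tsupport k
    · have : y * z ∉ tsupport f := fun hf => hz ⟨(y, y * z), ⟨hy, hf⟩, by simp⟩
      simp [image_eq_zero_of_notMem_tsupport this]
    · simp [image_eq_zero_of_notMem_tsupport hy]

theorem integral_abs_correlation_le [μ.IsMulLeftInvariant] (k f : C_c(H, ℝ)) :
    ∫ z, |correlation μ k f z| ∂μ ≤ (∫ y, |k y| ∂μ) * ∫ z, |f z| ∂μ := by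
  refine (integral_mono (integrable_compactlySupported μ |correlation μ k f|)
    (integrable_compactlySupported μ _) (abs_correlation_le μ k f)).trans ?_
  rw [integral_correlation]
  rfl

theorem continuous_integral_abs_leftTranslate_sub (f : C_c(H, ℝ)) :
    Continuous fun a => ∫ z, |f (a * z) - f z| ∂μ := by
  refine continuous_integral_of_locally_compact_support μ (g := fun a z => |f (a * z) - f z|)
    ?_ fun N hN => ⟨(fun p : H × H => p.1⁻¹ * p.2) '' (N ×ˢ tsupport f) ∪ tsupport f,
      ((hN.prod f.hasCompactSupport).image (by fun_prop)).union f.hasCompactSupport,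
      fun a ha z hz => ?_⟩
  · exact ((f.continuous.comp (continuous_fst.mul continuous_snd)).sub
        (f.continuous.comp continuous_snd)).abs
  · have h1 : a * z ∉ tsupport f := fun h => hz (Or.inl ⟨(a, a * z), ⟨ha, h⟩, by simp⟩)
    have h2 : z ∉ tsupport f := fun h => hz (Or.inr h)
    simp [image_eq_zero_of_notMem_tsupport h1, image_eq_zero_of_notMem_tsupport h2]

theorem continuous_integral_abs_rightTranslate_sub (f : C_c(H, ℝ)) :
    Continuous fun a => ∫ z, |f (z * a) - f z| ∂μ := by
  refine continuous_integral_of_locally_compact_support μ (g := fun a z => |f (z * a) - f z|)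
    ?_ fun N hN => ⟨(fun p : H × H => p.2 * p.1⁻¹) '' (N ×ˢ tsupport f) ∪ tsupport f,
      ((hN.prod f.hasCompactSupport).image (by fun_prop)).union f.hasCompactSupport,
      fun a ha z hz => ?_⟩
  · exact ((f.continuous.comp (continuous_snd.mul continuous_fst)).sub
        (f.continuous.comp continuous_snd)).abs
  · have h1 : z * a ∉ tsupport f := fun h => hz (Or.inl ⟨(a, z * a), ⟨ha, h⟩, by simp⟩)
    have h2 : z ∉ tsupport f := fun h => hz (Or.inr h)
    simp [image_eq_zero_of_notMem_tsupport h1, image_eq_zero_of_notMem_tsupport h2]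

/-- A positive left-invariant functional on `C_c(H)` is a multiple of the Haar integral. -/
theorem exists_eq_mul_integral_of_leftInvariant [T2Space H] (μ : Measure H) [μ.IsHaarMeasure]
    (J : C_c(H, ℝ) →ₗ[ℝ] ℝ) (hpos : ∀ f, 0 ≤ f → 0 ≤ J f)
    (hinv : ∀ a f, J (leftTranslate a f) = J f) :
    ∃ c : ℝ, ∀ f : C_c(H, ℝ), J f = c * ∫ z, f z ∂μ := by
  let Λ : C_c(H, ℝ) →ₚ[ℝ] ℝ := PositiveLinearMap.mk₀ J hpos
  have hΛ : ∀ f : C_c(H, ℝ), ∫ z, f z ∂(RealRMK.rieszMeasure Λ) = J f :=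
    RealRMK.integral_rieszMeasure Λ
  have : (RealRMK.rieszMeasure Λ).IsMulLeftInvariant := by
    refine ⟨fun a => ?_⟩
    -- Regularity of the translated measure lets equality be tested on compactly supported
    -- functions.
    have : ((RealRMK.rieszMeasure Λ).map (a * ·)).Regular :=
      Measure.Regular.map (Homeomorph.mulLeft a)
    refine Measure.ext_of_integral_eq_on_compactlySupported fun f => ?_
    rw [integral_map (measurable_const_mul a).aemeasurable (map_continuous f).aestronglyMeasurable, hΛ,
      ← hinv a f, ← hΛ]
    rfl
  refine ⟨(Measure.haarScalarFactor (RealRMK.rieszMeasure Λ) μ : ℝ), fun f => ?_⟩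
  rw [← hΛ, Measure.integral_isMulLeftInvariant_eq_smul_of_hasCompactSupport _ μ (map_continuous f)
    f.hasCompactSupport, integral_smul_nnreal_measure, NNReal.smul_def, smul_eq_mul]

end Correlation

end CompactlySupported

/-! ### Reiter's property from an invariant mean -/

section Reiter

variable {H : Type u} [Group H] [TopologicalSpace H] [IsTopologicalGroup H]
  [LocallyCompactSpace H] [MeasurableSpace H] [BorelSpace H]

theorem integral_abs_leftTranslate_sub_leftTranslate (μ : Measure H) [μ.IsMulLeftInvariant]
    (f : C_c(H, ℝ)) (a b : H) :
    ∫ z, |(leftTranslate a f - leftTranslate b f) z| ∂μ = ∫ z, |f (a * b⁻¹ * z) - f z| ∂μ := by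
  rw [← integral_mul_left_eq_self _ b⁻¹]
  simp [mul_assoc]

theorem integral_abs_rightTranslate_sub_rightTranslate (μ : Measure H) [μ.IsMulRightInvariant]
    (f : C_c(H, ℝ)) (a b : H) :
    ∫ z, |(rightTranslate a f - rightTranslate b f) z| ∂μ = ∫ z, |f (z * (b⁻¹ * a)) - f z| ∂μ := by
  rw [← integral_mul_right_eq_self _ b⁻¹]
  simp [mul_assoc]

variable (μ : Measure H) [μ.IsHaarMeasure]

/-- For an `L¹`-bounded functional `θ` on `C_c(H)` and `e ∈ C_c(H)`, the linear map that sends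
`k` to the bounded continuous function `x ↦ θ (correlation k (x • e))`. -/
def orbitFunction (θ : C_c(H, ℝ) →ₗ[ℝ] ℝ) (hθ : ∀ g, |θ g| ≤ ∫ z, |g z| ∂μ) (e : C_c(H, ℝ)) :
    C_c(H, ℝ) →ₗ[ℝ] (H →ᵇ ℝ) where
  toFun k := BoundedContinuousFunction.ofNormedAddCommGroup
    (fun x => θ (correlation μ k (leftTranslate x⁻¹ e)))
    (by
      refine continuous_iff_continuousAt.2 fun x => tendsto_iff_dist_tendsto_zero.2 ?_
      have hN : Tendsto (fun y => (∫ z, |k z| ∂μ) * ∫ z, |e (y⁻¹ * x⁻¹⁻¹ * z) - e z| ∂μ)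
          (𝓝 x) (𝓝 0) := by
        have h := ((continuous_integral_abs_leftTranslate_sub μ e).comp
          (continuous_inv.mul (continuous_const (y := x⁻¹⁻¹)))).const_mul (∫ z, |k z| ∂μ)
        simpa using h.tendsto x
      refine squeeze_zero (fun _ => dist_nonneg) (fun y => ?_) hN
      rw [Real.dist_eq, ← map_sub, ← correlationLinear_apply, ← correlationLinear_apply, ← map_sub,
        correlationLinear_apply]
      refine (hθ _).trans ((integral_abs_correlation_le μ _ _).trans (le_of_eq ?_))
      rw [integral_abs_leftTranslate_sub_leftTranslate])
    ((∫ z, |k z| ∂μ) * ∫ z, |e z| ∂μ)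
    (fun x => by
      refine (hθ _).trans ((integral_abs_correlation_le μ _ _).trans (le_of_eq ?_))
      simp only [leftTranslate_apply, integral_mul_left_eq_self (fun z => |e z|)])
  map_add' k k' := by
    ext x
    simp [correlation_add_left]
  map_smul' c k := by
    ext x
    simp [correlation_smul_left]

@[simp] theorem orbitFunction_apply (θ : C_c(H, ℝ) →ₗ[ℝ] ℝ) (hθ : ∀ g, |θ g| ≤ ∫ z, |g z| ∂μ)
    (e k : C_c(H, ℝ)) (x : H) :
    orbitFunction μ θ hθ e k x = θ (correlation μ k (leftTranslate x⁻¹ e)) := rfl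

/-- Averaging the orbit functions of a positive functional by an invariant mean gives a multiple
of the Haar integral. -/
theorem exists_mean_orbitFunction_eq_mul_integral [T2Space H] (m : (H →ᵇ ℝ) →ₗ[ℝ] ℝ)
    (m_nonneg : ∀ f : H →ᵇ ℝ, (∀ x, 0 ≤ f x) → 0 ≤ m f)
    (m_inv : ∀ (h : H) (f : H →ᵇ ℝ),
      m (f.compContinuous ⟨fun x => h * x, continuous_const_mul h⟩) = m f)
    (θ : C_c(H, ℝ) →ₗ[ℝ] ℝ) (hθ : ∀ g, |θ g| ≤ ∫ z, |g z| ∂μ) (θ_nonneg : ∀ g, 0 ≤ g → 0 ≤ θ g)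
    {e : C_c(H, ℝ)} (he : 0 ≤ e) :
    ∃ c : ℝ, ∀ k, m (orbitFunction μ θ hθ e k) = c * ∫ z, k z ∂μ := by
  refine exists_eq_mul_integral_of_leftInvariant μ (m ∘ₗ orbitFunction μ θ hθ e) (fun k hk => ?_)
    fun a k => ?_
  · exact m_nonneg _ fun x => θ_nonneg _ (correlation_nonneg μ hk fun z => he (x⁻¹ * z))
  · simp only [LinearMap.comp_apply]
    -- Translating `k` by `a` moves `x⁻¹` to `(a x)⁻¹` in the translate of `e`, so the orbit
    -- function is merely left translated.
    rw [← m_inv a (orbitFunction μ θ hθ e k)]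
    congr 1
    ext x
    simp only [orbitFunction_apply, BoundedContinuousFunction.compContinuous_apply,
      ContinuousMap.coe_mk, correlation_leftTranslate]
    congr 2
    ext z
    simp [mul_assoc]

theorem exists_nonneg_integral_eq_one :
    ∃ e : C_c(H, ℝ), 0 ≤ e ∧ ∫ z, e z ∂μ = 1 := by
  obtain ⟨g, hg, hg0, hg1⟩ := exists_continuous_nonneg_pos (1 : H)
  have hpos : 0 < ∫ z, g z ∂μ :=
    g.continuous.integral_pos_of_hasCompactSupport_nonneg_nonzero hg hg0 hg1
  refine ⟨(∫ z, g z ∂μ)⁻¹ • ⟨g, hg⟩, fun z => mul_nonneg (inv_nonneg.2 hpos.le) (hg0 z), ?_⟩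
  simp only [CompactlySupportedContinuousMap.smul_apply, CompactlySupportedContinuousMap.coe_mk,
    smul_eq_mul, integral_const_mul]
  exact inv_mul_cancel₀ hpos.ne'

theorem integrable_posPart (g : C_c(H, ℝ)) : Integrable (fun z => max (g z) 0) μ :=
  integrable_compactlySupported μ (g ⊔ 0)

/-- Zero integral means that the positive and negative parts have equal mass. -/
theorem integral_abs_eq_two_mul_integral_max {g : C_c(H, ℝ)} (hg : ∫ z, g z ∂μ = 0) :
    ∫ z, |g z| ∂μ = 2 * ∫ z, max (g z) 0 ∂μ := by
  have h : ∀ z, |g z| = 2 * max (g z) 0 - g z := fun z => by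
    rcases le_total 0 (g z) with h | h
    · rw [abs_of_nonneg h, max_eq_left h]; ring
    · rw [abs_of_nonpos h, max_eq_right h]; ring
  simp only [h]
  rw [integral_sub ((integrable_posPart μ g).const_mul 2) (integrable_compactlySupported μ g), hg,
    integral_const_mul, sub_zero]

/-- The nonnegative functions in `C_c(H)`, as a convex cone. -/
def nonnegCone (H : Type u) [TopologicalSpace H] : ConvexCone ℝ C_c(H, ℝ) where
  carrier := {f | 0 ≤ f}
  smul_mem' := fun _ hc _ hf z => mul_nonneg hc.le (hf z)
  add_mem' := fun _ hf _ hg z => add_nonneg (hf z) (hg z)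

/-- On an amenable group there are, in `L¹`, functions almost invariant under finitely many
differences of correlation operators. -/
theorem IsAmenable.exists_integral_abs_correlation_sub_le [T2Space H] [μ.IsMulRightInvariant]
    (hH : IsAmenable H) (u : C_c(H, ℝ)) (t : Finset H) {ε : ℝ} (hε : 0 < ε) :
    ∃ f : C_c(H, ℝ), 0 ≤ f ∧ ∫ z, f z ∂μ = 1 ∧
      ∀ s ∈ t, ∫ z, |correlation μ (rightTranslate s u - u) f z| ∂μ ≤ ε := by
  classical
  by_contra! hcon
  obtain ⟨m, m_nonneg, m_one, m_inv⟩ := hH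
  have hu : ∀ s, ∫ z, (rightTranslate s u - u) z ∂μ = 0 := fun s => by
    simp only [CompactlySupportedContinuousMap.sub_apply]
    rw [integral_sub (integrable_compactlySupported μ _) (integrable_compactlySupported μ _)]
    simp only [rightTranslate_apply, integral_mul_right_eq_self (fun z => u z), sub_self]
  -- Using the mass of the positive part instead of the `L¹` norm makes every functional dominated
  -- by `p` positive; for functions of zero integral it costs only a factor two, whence the `ε / 2`
  -- in `l`.
  let p : (t → C_c(H, ℝ)) → ℝ := fun F => ∑ s, ∫ z, max (F s z) 0 ∂μ
  have p_hom : ∀ c : ℝ, 0 < c → ∀ F, p (c • F) = c * p F := fun c hc F => by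
    simp only [p, Finset.mul_sum, ← integral_const_mul, Pi.smul_apply,
      CompactlySupportedContinuousMap.smul_apply, smul_eq_mul, mul_max_of_nonneg _ _ hc.le,
      mul_zero]
  have p_add : ∀ F F', p (F + F') ≤ p F + p F' := fun F F' => by
    simp only [p, ← Finset.sum_add_distrib]
    refine Finset.sum_le_sum fun s _ => ?_
    rw [← integral_add (integrable_posPart μ _) (integrable_posPart μ _)]
    refine integral_mono (integrable_posPart μ _)
      ((integrable_posPart μ _).add (integrable_posPart μ _)) fun z => ?_
    exact max_le (add_le_add (le_max_left _ _) (le_max_left _ _))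
      (add_nonneg (le_max_right _ _) (le_max_right _ _))
  have p_nonneg : ∀ F, 0 ≤ p F := fun F =>
    Finset.sum_nonneg fun s _ => integral_nonneg fun z => le_max_right _ _
  let T : C_c(H, ℝ) →ₗ[ℝ] t → C_c(H, ℝ) :=
    LinearMap.pi fun s : t => correlationLinear μ (rightTranslate (s : H) u - u)
  let l : C_c(H, ℝ) →ₗ[ℝ] ℝ :=
    { toFun := fun f => ε / 2 * ∫ z, f z ∂μ
      map_add' := fun f g => by
        simp only [CompactlySupportedContinuousMap.add_apply]
        rw [integral_add (integrable_compactlySupported μ f) (integrable_compactlySupported μ g),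
          mul_add]
      map_smul' := fun c f => by
        simp only [CompactlySupportedContinuousMap.smul_apply, smul_eq_mul, integral_const_mul,
          RingHom.id_apply]
        ring }
  have hl : ∀ f, l f = ε / 2 * ∫ z, f z ∂μ := fun f => rfl
  have hlp_one : ∀ f : C_c(H, ℝ), 0 ≤ f → ∫ z, f z ∂μ = 1 → l f ≤ p (T f) := fun f hf hf1 => by
    obtain ⟨s, hs, hlt⟩ := hcon f hf hf1
    rw [integral_abs_eq_two_mul_integral_max μ (by rw [integral_correlation, hu, zero_mul])] at hlt
    have : ∫ z, max (T f ⟨s, hs⟩ z) 0 ∂μ ≤ p (T f) :=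
      Finset.single_le_sum (f := fun s => ∫ z, max (T f s z) 0 ∂μ)
        (fun s _ => integral_nonneg fun z => le_max_right _ _) (Finset.mem_univ _)
    change ∫ z, max (correlation μ (rightTranslate s u - u) f z) 0 ∂μ ≤ _ at this
    rw [hl, hf1]
    linarith
  -- Homogeneity reduces the cone condition to densities; functions of integral zero are treated
  -- apart because they cannot be normalized.
  obtain ⟨Θ, hΘp, hΘl⟩ := exists_linearMap_le_sublinear p p_hom p_add (nonnegCone H) (le_refl (0 : C_c(H, ℝ))) T l
    fun f (hf : 0 ≤ f) => by
      rcases (integral_nonneg hf : 0 ≤ ∫ z, f z ∂μ).eq_or_lt with h0 | h0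
      · rw [hl, ← h0, mul_zero]
        exact p_nonneg _
      · have h1 := hlp_one ((∫ z, f z ∂μ)⁻¹ • f)
          (fun z => mul_nonneg (inv_nonneg.2 h0.le) (hf z)) (by
            simp only [CompactlySupportedContinuousMap.smul_apply, smul_eq_mul, integral_const_mul]
            exact inv_mul_cancel₀ h0.ne')
        rw [map_smul, map_smul, p_hom _ (inv_pos.2 h0), smul_eq_mul] at h1
        exact le_of_mul_le_mul_left h1 (inv_pos.2 h0)
  let θ : t → C_c(H, ℝ) →ₗ[ℝ] ℝ := fun s => Θ ∘ₗ LinearMap.single ℝ (fun _ : t => C_c(H, ℝ)) s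
  have hθ : ∀ s g, θ s g ≤ ∫ z, max (g z) 0 ∂μ := fun s g => by
    refine (hΘp _).trans (le_of_eq ?_)
    refine (Finset.sum_eq_single s (fun b _ hb => ?_) (by simp)).trans ?_
    · simp [Pi.single_eq_of_ne hb]
    · simp
  -- `-g` has no positive part, so `θ s (-g) ≤ 0`.
  have θ_nonneg : ∀ s g, 0 ≤ g → 0 ≤ θ s g := fun s g hg => by
    have h := hθ s (-g)
    rw [map_neg, integral_eq_zero_of_ae (Eventually.of_forall fun z => by
      simpa using hg z)] at h
    linarith
  have θ_abs : ∀ s g, |θ s g| ≤ ∫ z, |g z| ∂μ := fun s g => by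
    refine abs_le'.2 ⟨(hθ s g).trans ?_, ?_⟩
    · exact integral_mono (integrable_posPart μ g) (integrable_compactlySupported μ |g|)
        fun z => max_le (le_abs_self _) (abs_nonneg _)
    · rw [← map_neg]
      refine (hθ s (-g)).trans ?_
      exact integral_mono (integrable_posPart μ (-g)) (integrable_compactlySupported μ |g|)
        fun z => max_le (neg_le_abs _) (abs_nonneg _)
  obtain ⟨e, he, he1⟩ := exists_nonneg_integral_eq_one μ
  have hsum : ∀ s : t, m (orbitFunction μ (θ s) (θ_abs s) e (rightTranslate (s : H) u - u)) = 0 := by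
    intro s
    obtain ⟨c, hc⟩ := exists_mean_orbitFunction_eq_mul_integral μ m m_nonneg m_inv (θ s)
      (θ_abs s) (θ_nonneg s) he
    rw [hc, hu, mul_zero]
  -- At each `x` the translate of `e` is a density, so the orbit functions sum to at least `ε / 2`;
  -- yet each of them has mean zero.
  have hfin := m_nonneg
    (∑ s : t, orbitFunction μ (θ s) (θ_abs s) e (rightTranslate (s : H) u - u) -
      (ε / 2) • BoundedContinuousFunction.const H 1) fun x => by
      have h := hΘl (leftTranslate x⁻¹ e) fun z => he (x⁻¹ * z)
      have hx : Θ (T (leftTranslate x⁻¹ e)) =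
          ∑ s : t, θ s (correlation μ (rightTranslate (s : H) u - u) (leftTranslate x⁻¹ e)) := by
        conv_lhs => rw [← Finset.univ_sum_single (T (leftTranslate x⁻¹ e)), map_sum]
        rfl
      rw [hx, hl] at h
      simp only [leftTranslate_apply, integral_mul_left_eq_self (fun z => e z), he1] at h
      simp only [BoundedContinuousFunction.coe_sub, BoundedContinuousFunction.coe_sum,
        BoundedContinuousFunction.coe_smul, Pi.sub_apply, Finset.sum_apply, orbitFunction_apply,
        BoundedContinuousFunction.const_apply, smul_eq_mul]
      linarith
  rw [map_sub, map_sum, Finset.sum_congr rfl fun s _ => hsum s, map_smul, m_one] at hfin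
  simp only [Finset.sum_const_zero, smul_eq_mul] at hfin
  linarith

/-- **Reiter's property** of a unimodular amenable group: there are nonnegative functions of
integral one that are almost invariant in `L¹` under the translations by a compact set. -/
theorem IsAmenable.exists_integral_abs_leftTranslate_sub_le [T2Space H] [μ.IsMulRightInvariant]
    (hH : IsAmenable H) {K : Set H} (hK : IsCompact K) {ε : ℝ} (hε : 0 < ε) :
    ∃ f : C_c(H, ℝ), 0 ≤ f ∧ ∫ z, f z ∂μ = 1 ∧
      ∀ h ∈ K, ∫ z, |f (h * z) - f z| ∂μ ≤ ε := by
  obtain ⟨u, hu, hu1⟩ := exists_nonneg_integral_eq_one μ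
  have hcont := continuous_integral_abs_rightTranslate_sub μ u
  -- The set at `s` consists of the `h` for which the right translates of `u` by `h⁻¹` and `s` are
  -- `ε / 2`-close in `L¹`; `h` itself is covered by `s = h⁻¹`. Smoothing by `u` thus reduces a
  -- compact set to finitely many `s`.
  obtain ⟨t, ht⟩ := hK.elim_finite_subcover
    (fun s : H => {h | ∫ z, |u (z * (s⁻¹ * h⁻¹)) - u z| ∂μ < ε / 2})
    (fun s => isOpen_lt (hcont.comp (continuous_const.mul continuous_inv)) continuous_const)
    fun h _ => mem_iUnion.2 ⟨h⁻¹, by simpa using half_pos hε⟩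
  obtain ⟨f, hf, hf1, hft⟩ := hH.exists_integral_abs_correlation_sub_le μ u t (half_pos hε)
  refine ⟨correlation μ u f, correlation_nonneg μ hu hf, ?_, fun h hh => ?_⟩
  · rw [integral_correlation, hu1, hf1, one_mul]
  · obtain ⟨s, hs, hsh⟩ : ∃ s ∈ t, ∫ z, |u (z * (s⁻¹ * h⁻¹)) - u z| ∂μ < ε / 2 := by
      simpa using ht hh
    have hdecomp : leftTranslate h (correlation μ u f) - correlation μ u f =
        correlation μ (rightTranslate h⁻¹ u - rightTranslate s u) f +
          correlation μ (rightTranslate s u - u) f := by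
      rw [← correlation_add_left, leftTranslate_correlation, sub_add_sub_cancel]
      exact (LinearMap.congr_fun (map_sub (correlationLinear μ) _ _) f).symm
    have h1 : ∫ z, |correlation μ (rightTranslate h⁻¹ u - rightTranslate s u) f z| ∂μ ≤ ε / 2 := by
      refine (integral_abs_correlation_le μ _ _).trans ?_
      have : ∫ z, |f z| ∂μ = 1 := by
        rw [← hf1]
        exact integral_congr_ae (Eventually.of_forall fun z => abs_of_nonneg (hf z))
      rw [this, mul_one, integral_abs_rightTranslate_sub_rightTranslate]
      exact hsh.le
    calc ∫ z, |correlation μ u f (h * z) - correlation μ u f z| ∂μ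
        = ∫ z, |(leftTranslate h (correlation μ u f) - correlation μ u f) z| ∂μ := rfl
      _ ≤ ∫ z, (|correlation μ (rightTranslate h⁻¹ u - rightTranslate s u) f z| +
            |correlation μ (rightTranslate s u - u) f z|) ∂μ := by
          rw [hdecomp]
          exact integral_mono (integrable_compactlySupported μ |_|)
            ((integrable_compactlySupported μ |_|).add (integrable_compactlySupported μ |_|))
            fun z => abs_add_le _ _
      _ ≤ ε / 2 + ε / 2 := by
          refine (integral_add (integrable_compactlySupported μ |_|)
            (integrable_compactlySupported μ |_|)).trans_le ?_
          exact add_le_add h1 (hft s hs)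
      _ = ε := add_halves ε

end Reiter

open scoped ComplexOrder TensorProduct

/-! ### Positive-definite functions and the regular representation -/

section PositiveDefinite

variable {H : Type u} [Group H] [TopologicalSpace H] [IsTopologicalGroup H]
  [LocallyCompactSpace H] [MeasurableSpace H] [BorelSpace H]

/-- The square root of a real function in `C_c(H)`. -/
def sqrtCompactlySupported (f : C_c(H, ℝ)) : C_c(H, ℝ) where
  toFun z := √(f z)
  continuous_toFun := Real.continuous_sqrt.comp (map_continuous f)
  hasCompactSupport' := f.hasCompactSupport.comp_left Real.sqrt_zero

/-- Turns almost invariance of a density in `L¹` into almost invariance of its square root in `L²`.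
-/
theorem sq_sqrt_sub_sqrt_le {a b : ℝ} (ha : 0 ≤ a) (hb : 0 ≤ b) : (√a - √b) ^ 2 ≤ |a - b| := by
  have h : |√a - √b| ≤ |√a + √b| := by
    rw [abs_of_nonneg (add_nonneg (Real.sqrt_nonneg a) (Real.sqrt_nonneg b)), abs_le]
    constructor <;> linarith [Real.sqrt_nonneg a, Real.sqrt_nonneg b]
  calc (√a - √b) ^ 2 = |√a - √b| * |√a - √b| := by rw [abs_mul_abs_self, sq]
    _ ≤ |√a - √b| * |√a + √b| := mul_le_mul_of_nonneg_left h (abs_nonneg _)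
    _ = |a - b| := by
      rw [← abs_mul]
      congr 1
      linear_combination Real.mul_self_sqrt ha - Real.mul_self_sqrt hb

variable (μ : Measure H) [μ.IsHaarMeasure]

theorem continuous_autocorrelation (ξ : C_c(H, ℝ)) :
    Continuous fun h => ∫ x, ξ (h * x) * ξ x ∂μ :=
  continuous_integral_of_locally_compact_support μ (g := fun h x => ξ (h * x) * ξ x)
    (((map_continuous ξ).comp (continuous_fst.mul continuous_snd)).mul
      ((map_continuous ξ).comp continuous_snd))
    fun _ _ => ⟨tsupport ξ, ξ.hasCompactSupport, fun h x _ hx => by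
      simp only [image_eq_zero_of_notMem_tsupport hx, mul_zero]⟩

/-- The matrix coefficient of the left regular representation at the square root of a density is
controlled by the displacement of the density in `L¹`. -/
theorem abs_one_sub_autocorrelation_sqrt_le {f : C_c(H, ℝ)} (hf : 0 ≤ f) (hf1 : ∫ z, f z ∂μ = 1)
    (h : H) :
    |1 - ∫ x, sqrtCompactlySupported f (h * x) * sqrtCompactlySupported f x ∂μ| ≤
      (∫ z, |f (h * z) - f z| ∂μ) / 2 := by
  set ξ := sqrtCompactlySupported f with hξ
  have hξf : ∀ x, ξ x * ξ x = f x := fun x => Real.mul_self_sqrt (hf x)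
  have hi : Integrable (fun x => ξ (h * x) * ξ x) μ :=
    integrable_compactlySupported μ (leftTranslate h ξ * ξ)
  have hif : Integrable (fun x => f (h * x)) μ :=
    integrable_compactlySupported μ (leftTranslate h f)
  -- Expanding the square: `√f` and its translate are unit vectors in `L²`.
  have key : 1 - ∫ x, ξ (h * x) * ξ x ∂μ = (∫ x, (ξ (h * x) - ξ x) ^ 2 ∂μ) / 2 := by
    have h2 : ∀ x, (ξ (h * x) - ξ x) ^ 2 = f (h * x) + f x - 2 * (ξ (h * x) * ξ x) := fun x => by
      rw [← hξf, ← hξf]; ring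
    have h3 : Integrable (fun x => f (h * x) + f x) μ :=
      hif.add (integrable_compactlySupported μ f)
    simp only [h2]
    rw [integral_sub h3 (hi.const_mul 2),
      integral_add hif (integrable_compactlySupported μ f), integral_const_mul,
      integral_mul_left_eq_self (fun z => f z), hf1]
    ring
  rw [key, abs_of_nonneg (div_nonneg (integral_nonneg fun x => sq_nonneg _) two_pos.le)]
  refine div_le_div_of_nonneg_right ?_ two_pos.le
  let d : C_c(H, ℝ) := leftTranslate h ξ - ξ
  refine integral_mono ((integrable_compactlySupported μ (d * d)).congr
    (Eventually.of_forall fun x => (sq (d x)).symm))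
    (integrable_compactlySupported μ |leftTranslate h f - f|) fun x => ?_
  exact sq_sqrt_sub_sqrt_le (hf _) (hf x)

/-- On a unimodular amenable group, a function in `C_c(H)` that is positive as a convolution
operator on the left regular representation has nonnegative integral. -/
theorem IsAmenable.integral_nonneg [T2Space H] [μ.IsMulRightInvariant] (hH : IsAmenable H)
    {G : H → ℂ} (hGc : Continuous G) (hGs : HasCompactSupport G)
    (hG : ∀ ξ : C_c(H, ℝ), 0 ≤ ∫ h, G h * ((∫ x, ξ (h * x) * ξ x ∂μ : ℝ) : ℂ) ∂μ) :
    0 ≤ ∫ h, G h ∂μ := by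
  have hclosed : IsClosed {z : ℂ | 0 ≤ z} := isClosed_le continuous_const continuous_id
  refine hclosed.closure_subset (Metric.mem_closure_iff.2 fun δ hδ => ?_)
  set C := ∫ h, ‖G h‖ ∂μ
  have hC : 0 ≤ C := MeasureTheory.integral_nonneg fun _ => norm_nonneg _
  -- The `+ 1` avoids division by zero and makes the final inequality strict.
  obtain ⟨f, hf, hf1, hfK⟩ := hH.exists_integral_abs_leftTranslate_sub_le μ hGs
    (div_pos hδ (by linarith : 0 < C + 1))
  have hGi : Integrable G μ := hGc.integrable_of_hasCompactSupport hGs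
  refine ⟨_, hG (sqrtCompactlySupported f), ?_⟩
  have hGi' : Integrable (fun h => G h * ((∫ x, sqrtCompactlySupported f (h * x) *
      sqrtCompactlySupported f x ∂μ : ℝ) : ℂ)) μ :=
    (hGc.mul (Complex.continuous_ofReal.comp
      (continuous_autocorrelation μ _))).integrable_of_hasCompactSupport hGs.mul_right
  rw [dist_eq_norm, ← integral_sub hGi hGi']
  calc _ ≤ ∫ h, ‖G h‖ * (δ / (C + 1)) ∂μ := by
        refine norm_integral_le_of_norm_le (hGi.norm.mul_const _) (Eventually.of_forall fun h => ?_)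
        rw [← mul_one_sub, norm_mul]
        by_cases hh : h ∈ tsupport G
        · refine mul_le_mul_of_nonneg_left ?_ (norm_nonneg _)
          rw [← Complex.ofReal_one, ← Complex.ofReal_sub, Complex.norm_real, Real.norm_eq_abs]
          have h1 := abs_one_sub_autocorrelation_sqrt_le μ hf hf1 h
          have h2 := hfK h hh
          have h3 : 0 ≤ ∫ z, |f (h * z) - f z| ∂μ :=
            MeasureTheory.integral_nonneg fun _ => abs_nonneg _
          linarith
        · simp [image_eq_zero_of_notMem_tsupport hh]
    _ = C * δ / (C + 1) := by rw [integral_mul_const, mul_div_assoc]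
    _ < δ := by
        rw [div_lt_iff₀ (by linarith)]
        linarith

/-- A continuous field of vectors whose Gram kernel is `(y, x) ↦ G (y x⁻¹)` makes `G` positive as a
convolution operator on the left regular representation. -/
theorem integral_mul_autocorrelation_nonneg [μ.IsMulRightInvariant]
    {V : Type*} [NormedAddCommGroup V] [InnerProductSpace ℂ V] [CompleteSpace V]
    {G : H → ℂ} (hGc : Continuous G) (hGs : HasCompactSupport G) {w : H → V} (hw : Continuous w)
    (hwG : ∀ x y, inner ℂ (w y) (w x) = G (y * x⁻¹)) (ξ : C_c(H, ℝ)) :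
    0 ≤ ∫ h, G h * ((∫ x, ξ (h * x) * ξ x ∂μ : ℝ) : ℂ) ∂μ := by
  have hξc : Continuous fun x => (ξ x : ℂ) := Complex.continuous_ofReal.comp (map_continuous ξ)
  have hi : Integrable (fun x => (ξ x : ℂ) • w x) μ :=
    (hξc.smul hw).integrable_of_hasCompactSupport
      (HasCompactSupport.smul_right (ξ.hasCompactSupport.comp_left Complex.ofReal_zero))
  -- The squared norm of the vector `∫ ξ(x) w(x) dx`; the substitution `y ↦ y x` below brings it to
  -- the required form.
  have h1 : inner ℂ (∫ x, (ξ x : ℂ) • w x ∂μ) (∫ x, (ξ x : ℂ) • w x ∂μ) =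
      ∫ x, ∫ y, G (y * x⁻¹) * (ξ y * ξ x) ∂μ ∂μ := by
    rw [← integral_inner hi]
    refine integral_congr_ae (Eventually.of_forall fun x => ?_)
    simp only
    rw [← inner_conj_symm, ← integral_inner hi, ← integral_conj]
    refine integral_congr_ae (Eventually.of_forall fun y => ?_)
    simp only
    rw [inner_conj_symm, inner_smul_left, inner_smul_right, hwG, Complex.conj_ofReal]
    ring
  have h2 : ∫ x, ∫ y, G (y * x⁻¹) * (ξ y * ξ x) ∂μ ∂μ =
      ∫ h, G h * ((∫ x, ξ (h * x) * ξ x ∂μ : ℝ) : ℂ) ∂μ := by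
    have h3 : ∀ x, ∫ y, G (y * x⁻¹) * (ξ y * ξ x) ∂μ = ∫ y, G y * (ξ (y * x) * ξ x) ∂μ := by
      intro x
      rw [← integral_mul_right_eq_self _ x]
      simp
    simp only [h3]
    rw [integral_integral_swap_of_hasCompactSupport]
    · refine integral_congr_ae (Eventually.of_forall fun y => ?_)
      simp only
      rw [integral_const_mul, ← integral_complex_ofReal]
      simp only [Complex.ofReal_mul]
    · exact (hGc.comp continuous_snd).mul ((hξc.comp (continuous_snd.mul continuous_fst)).mul
        (hξc.comp continuous_fst))
    · refine HasCompactSupport.intro (ξ.hasCompactSupport.isCompact.prod hGs) ?_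
      rintro ⟨x, y⟩ hxy
      simp only [uncurry_apply_pair]
      by_cases hx : x ∈ tsupport ξ
      · have : y ∉ tsupport G := fun hy => hxy ⟨hx, hy⟩
        simp [image_eq_zero_of_notMem_tsupport this]
      · simp [image_eq_zero_of_notMem_tsupport hx]
  rw [← h2, ← h1, inner_self_eq_norm_sq_to_K]
  exact pow_nonneg (Complex.zero_le_real.2 (norm_nonneg (∫ x, (ξ x : ℂ) • w x ∂μ))) 2

/-- The inverses make the Gram kernel a function of `y x⁻¹`, matched to right invariance of the
measure. -/
theorem UnitaryRep.inner_op_inv_op_inv {E : Type v} [NormedAddCommGroup E] [InnerProductSpace ℂ E]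
    [CompleteSpace E] (π : UnitaryRep H E) (x y : H) (η : E) :
    inner ℂ (π.op y⁻¹ η) (π.op x⁻¹ η) = π.coeff η η (y * x⁻¹) := by
  have h1 : π.op y⁻¹ = star (π.op y) := by
    simp only [UnitaryRep.op, map_inv]
    rfl
  have h2 : π.op (y * x⁻¹) = π.op y * π.op x⁻¹ := by
    simp only [UnitaryRep.op, map_mul]
    rfl
  rw [h1, ContinuousLinearMap.star_eq_adjoint, ContinuousLinearMap.adjoint_inner_left,
    UnitaryRep.coeff, h2, mul_apply_eq_comp]

/-- On a unimodular amenable group, if a diagonal matrix coefficient has compact support, then its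
product with any diagonal matrix coefficient has nonnegative integral. -/
theorem IsAmenable.integral_coeff_mul_coeff_nonneg [T2Space H] [μ.IsMulRightInvariant]
    (hH : IsAmenable H) {E : Type*} [NormedAddCommGroup E] [InnerProductSpace ℂ E]
    [CompleteSpace E] {E' : Type*} [NormedAddCommGroup E'] [InnerProductSpace ℂ E']
    [CompleteSpace E'] (π : UnitaryRep H E) (ρ : UnitaryRep H E') (η : E) (v : E')
    (hη : HasCompactSupport (π.coeff η η)) :
    0 ≤ ∫ h, π.coeff η η h * ρ.coeff v v h ∂μ := by
  have hc : Continuous fun h => π.coeff η η h * ρ.coeff v v h :=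
    (π.continuous_coeff η η).mul (ρ.continuous_coeff v v)
  refine hH.integral_nonneg μ hc hη.mul_right
    (integral_mul_autocorrelation_nonneg μ hc hη.mul_right
      -- The orbit of `η ⊗ v`; its Gram kernel multiplies the two coefficients. The completion is
      -- needed for the vector-valued integral.
      (w := fun x => ((π.op x⁻¹ η ⊗ₜ[ℂ] ρ.op x⁻¹ v : E ⊗[ℂ] E') :
        UniformSpace.Completion (E ⊗[ℂ] E'))) ?_ fun x y => ?_)
  · exact (UniformSpace.Completion.continuous_coe _).comp (TensorProduct.continuous_tmul.comp
      (((π.continuous_op η).comp continuous_inv).prodMk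
        ((ρ.continuous_op v).comp continuous_inv)))
  · rw [UniformSpace.Completion.inner_coe, TensorProduct.inner_tmul, π.inner_op_inv_op_inv,
      ρ.inner_op_inv_op_inv]

end PositiveDefinite

/-! ### Testing positivity in `C*(H)` representation by representation -/

section GroupCStarAlgebra

variable {H : Type u} [Group H] [TopologicalSpace H] [MeasurableSpace H] [BorelSpace H]
  (μ : Measure H) [IsFiniteMeasureOnCompacts μ]

/-- The extension of a unitary representation to the group `C*`-algebra. -/
def evalRep (π : BundledRep H) : GroupCStar μ →⋆ₙₐ[ℂ] (π.space →L[ℂ] π.space) where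
  toFun a := (a.1 : OpFamilies H) π
  map_smul' _ _ := rfl
  map_zero' := rfl
  map_add' _ _ := rfl
  map_mul' _ _ := rfl
  map_star' _ := rfl

theorem evalRep_toGroupCStar (π : BundledRep H) (f : C_c(H, ℂ)) :
    evalRep μ π (toGroupCStar μ f) = π.rep.integrated μ f := rfl

variable {μ}

theorem GroupCStar.ext_evalRep {a b : GroupCStar μ} (h : ∀ π, evalRep μ π a = evalRep μ π b) :
    a = b :=
  Subtype.ext (lp.ext (funext h))

/-- An element of the group `C*`-algebra is positive if it is positive in every unitary
representation. -/
theorem GroupCStar.nonneg_of_evalRep_nonneg {a : GroupCStar μ} (h : ∀ π, 0 ≤ evalRep μ π a) :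
    0 ≤ a := by
  have ha : IsSelfAdjoint a := GroupCStar.ext_evalRep fun π => by
    rw [map_star]
    exact (IsSelfAdjoint.of_nonneg (h π)).star_eq
  -- The negative part is formed by functional calculus, so it commutes with every `evalRep`; it
  -- vanishes in each representation, and these separate points.
  rw [← CFC.negPart_eq_zero_iff a ha]
  refine GroupCStar.ext_evalRep fun π => ?_
  have hcont : Continuous (evalRep μ π) :=
    (AddMonoidHomClass.lipschitz_of_bound_nnnorm (evalRep μ π) 1 fun x => by
      rw [one_mul]
      exact NonUnitalStarAlgHom.nnnorm_apply_le (evalRep μ π) x).continuous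
  rw [map_zero, CFC.negPart_def, NonUnitalStarAlgHom.map_cfcₙ (S := ℂ) (evalRep μ π) _ a
    (hφ := hcont) (ha := ha) (hφa := IsSelfAdjoint.of_nonneg (h π)), ← CFC.negPart_def,
    CFC.negPart_eq_zero_iff _ (IsSelfAdjoint.of_nonneg (h π))]
  exact h π

end GroupCStarAlgebra

/-! ### Matrix coefficients, commuting operators and integrated forms -/

theorem UnitaryRep.inner_integrated {H : Type u} [Group H] [TopologicalSpace H]
    [MeasurableSpace H] [BorelSpace H] (μ : Measure H) [IsFiniteMeasureOnCompacts μ]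
    {E : Type*} [NormedAddCommGroup E] [InnerProductSpace ℂ E] [CompleteSpace E]
    (ρ : UnitaryRep H E) (f : C_c(H, ℂ)) (v : E) :
    inner ℂ v (ρ.integrated μ f v) = ∫ h, f h * ρ.coeff v v h ∂μ := by
  change inner ℂ v (∫ h, f h • ρ.op h v ∂μ) = _
  rw [← integral_inner (ρ.integrable_smul_op μ f v)]
  simp only [inner_smul_right, UnitaryRep.coeff]

theorem clm_nonneg_of_inner_nonneg {E : Type*} [NormedAddCommGroup E]
    [InnerProductSpace ℂ E] [CompleteSpace E] {T : E →L[ℂ] E} (h : ∀ v, 0 ≤ inner ℂ v (T v)) :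
    0 ≤ T := by
  rw [ContinuousLinearMap.nonneg_iff_isPositive,
    ContinuousLinearMap.isPositive_iff_complex]
  intro v
  have h1 : 0 ≤ inner ℂ (T v) v := by
    rw [← inner_conj_symm]
    simpa using star_nonneg_iff.2 (h v)
  obtain ⟨h2, h3⟩ := Complex.nonneg_iff.1 h1
  exact ⟨Complex.ext rfl (by simpa using h3), h2⟩

/-- A bounded operator commuting with a unitary representation changes diagonal matrix
coefficients, up to its squared norm, by a diagonal matrix coefficient. -/
theorem UnitaryRep.exists_coeff_eq_sub {H : Type u} [Group H] [TopologicalSpace H]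
    {E : Type*} [NormedAddCommGroup E] [InnerProductSpace ℂ E] [CompleteSpace E]
    (π : UnitaryRep H E) {A : E →L[ℂ] E} (hA : ∀ h, Commute A (π.op h)) (ψ : E) :
    ∃ η : E, ∀ h, π.coeff η η h =
      ((‖A‖ ^ 2 : ℝ) : ℂ) * π.coeff ψ ψ h - π.coeff (A ψ) (A ψ) h := by
  set D : E →L[ℂ] E := algebraMap ℝ _ (‖A‖ ^ 2) - star A * A with hD
  have hD0 : 0 ≤ D := sub_nonneg.2 CStarAlgebra.star_mul_le_algebraMap_norm_sq
  have hstar : ∀ h, star (π.op h) = π.op h⁻¹ := fun h => by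
    simp only [UnitaryRep.op, map_inv]
    rfl
  -- The operators `π(h)` form a self-adjoint set, so their commutant is closed under adjoints; no
  -- Fuglede-type argument is required.
  have hA' : ∀ h, Commute (star A) (π.op h) := fun h => by
    have := (hA h⁻¹).star_star
    rwa [hstar, inv_inv] at this
  have hcomm : ∀ h, Commute D (π.op h) := fun h =>
    Commute.sub_left (Algebra.commutes _ _) ((hA' h).mul_left (hA h))
  set S := CFC.sqrt D with hS
  have hScomm : ∀ h, Commute S (π.op h) := fun h => (hcomm h).cfcₙ_nnreal _
  have hSself : star S = S := (IsSelfAdjoint.of_nonneg (CFC.sqrt_nonneg D)).star_eq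
  have hSS : S * S = D := CFC.sqrt_mul_sqrt_self D hD0
  refine ⟨S ψ, fun h => ?_⟩
  have e1 : inner ℂ (S ψ) (π.op h (S ψ)) = inner ℂ ψ (D (π.op h ψ)) := by
    have : π.op h (S ψ) = S (π.op h ψ) := (congrArg (· ψ) (hScomm h).eq).symm
    rw [this, ← hSS, mul_apply_eq_comp, ← ContinuousLinearMap.adjoint_inner_left S _ ψ,
      ← ContinuousLinearMap.star_eq_adjoint, hSself]
  have e2 : inner ℂ (A ψ) (π.op h (A ψ)) = inner ℂ ψ (star A (A (π.op h ψ))) := by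
    have : π.op h (A ψ) = A (π.op h ψ) := (congrArg (· ψ) (hA h).eq).symm
    rw [this, ContinuousLinearMap.star_eq_adjoint, ContinuousLinearMap.adjoint_inner_right]
  rw [UnitaryRep.coeff, UnitaryRep.coeff, UnitaryRep.coeff, e1, e2, hD]
  simp only [sub_apply, mul_apply_eq_comp, inner_sub_right,
    Algebra.algebraMap_eq_smul_one, smul_apply, one_apply_eq_self,
    inner_smul_right_eq_smul, Complex.real_smul]

/-- On a unimodular amenable group, a function in `C_c(H)` that is a diagonal matrix coefficient
acts by a positive operator in every unitary representation. The function is given as a difference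
`c • f - g`. -/
theorem IsAmenable.smul_integrated_sub_integrated_nonneg {H : Type u} [Group H]
    [TopologicalSpace H] [IsTopologicalGroup H] [LocallyCompactSpace H] [T2Space H]
    [MeasurableSpace H] [BorelSpace H] (μ : Measure H) [μ.IsHaarMeasure] [μ.IsMulRightInvariant]
    (hH : IsAmenable H) {E : Type*} [NormedAddCommGroup E] [InnerProductSpace ℂ E]
    [CompleteSpace E] {E' : Type*} [NormedAddCommGroup E'] [InnerProductSpace ℂ E']
    [CompleteSpace E'] (π : UnitaryRep H E) (ρ : UnitaryRep H E') {η : E} {c : ℂ}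
    {f g : C_c(H, ℂ)} (hη : ∀ h, π.coeff η η h = c * f h - g h) :
    0 ≤ c • ρ.integrated μ f - ρ.integrated μ g := by
  -- `η` need not lie in the subspace `L`; compact support of its coefficient is read off from `c •
  -- f - g`.
  have hηs : HasCompactSupport (π.coeff η η) := by
    have h : π.coeff η η = ⇑(c • f - g) := funext hη
    rw [h]
    exact CompactlySupportedContinuousMap.hasCompactSupport _
  refine clm_nonneg_of_inner_nonneg fun v => ?_
  have hint : ∀ k : C_c(H, ℂ), Integrable (fun h => k h * ρ.coeff v v h) μ := fun k =>
    ((map_continuous k).mul (ρ.continuous_coeff v v)).integrable_of_hasCompactSupport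
      k.hasCompactSupport.mul_right
  rw [sub_apply, smul_apply, inner_sub_right, inner_smul_right, ρ.inner_integrated μ,
    ρ.inner_integrated μ, ← integral_const_mul, ← integral_sub ((hint f).const_mul c) (hint g)]
  refine (hH.integral_coeff_mul_coeff_nonneg μ π ρ η v hηs).trans_eq
    (integral_congr_ae (Eventually.of_forall fun h => ?_))
  simp only [hη, sub_mul, mul_assoc]

end RieffelInduction

end

open RieffelInduction
theorem proposition3
    {H : Type u} [Group H] [TopologicalSpace H] [IsTopologicalGroup H] [LocallyCompactSpace H]
    [T2Space H] [MeasurableSpace H] [BorelSpace H]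
    (μ : Measure H) [μ.IsHaarMeasure] [μ.Regular] [μ.IsMulRightInvariant]
    (hH : IsAmenable H)
    {E : Type v} [NormedAddCommGroup E] [InnerProductSpace ℂ E] [CompleteSpace E]
    (π : UnitaryRep H E) (L : Submodule ℂ E) (hL : π.HasCompactCoeffs L)
    (A : E →L[ℂ] E) (hA : ∀ h : H, Commute A (π.op h))
    (ψ : L) (hAψ : A ψ ∈ L) :
    toGroupCStar μ (π.rigging hL ⟨A ψ, hAψ⟩ ⟨A ψ, hAψ⟩) ≤
      ((‖A‖ ^ 2 : ℝ) : ℂ) • toGroupCStar μ (π.rigging hL ψ ψ) := by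
  rw [← sub_nonneg]
  refine GroupCStar.nonneg_of_evalRep_nonneg fun ρ => ?_
  obtain ⟨η, hη⟩ := π.exists_coeff_eq_sub hA ψ
  rw [map_sub, map_smul, evalRep_toGroupCStar, evalRep_toGroupCStar]
  exact hH.smul_integrated_sub_integrated_nonneg μ π ρ.rep hη
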